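/- For an integer $m\ge 0$ and an integer $k$, let $\binom{m}{k}$ denote the usual binomial coefficient, which is $0$ if $k<0$ or $k>m$. For an integer $\alpha$ let $(\alpha)_k:=\alpha(\alpha+1)\cdots(\alpha+k-1)$ for $k\ge 1$, and $(\alpha)_0:=1$. **Theorem 1.10.** Let $n$ be a positive integer, let $x$ and $y$ be nonnegative integers, and let $A_n(x,y)$ be the matrix $$A_n(x,y):=\left(\binom{x+y+j}{x-i+2j}-\binom{x+y+j}{x+i+2j}\right)_{1\le i,j\le n}.$$ Then $$\det A_n(x,y)=\prod_{j=1}^{n}\frac{(j-1)!\,(x+y+2j)!\,(x-y+2j+1)_j\,(x+2y+3j+1)_{n-j}}{(x+n+2j)!\,(y+n-j)!}.$$ -/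

import Mathlib

/-- The binomial coefficient with a natural upper index and an integer lower index:
it vanishes when the lower index is negative (and, as usual, when it exceeds the upper one). -/
def intBinom (m : ℕ) (k : ℤ) : ℤ :=
  if 0 ≤ k then (m.choose k.toNat : ℤ) else 0

/-- The matrix whose entry in row `i` and column `j`, for `1 ≤ i, j ≤ n`, is
`binom(x+y+j, x-i+2j) - binom(x+y+j, x+i+2j)`. The index `a : Fin n` stands for `i = a + 1`,
and `b : Fin n` for `j = b + 1`. -/
def matrixA (n x y : ℕ) : Matrix (Fin n) (Fin n) ℤ :=
  Matrix.of fun a b =>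
    let i : ℕ := a.val + 1
    let j : ℕ := b.val + 1
    intBinom (x + y + j) ((x : ℤ) - (i : ℤ) + 2 * (j : ℤ)) -
      intBinom (x + y + j) ((x : ℤ) + (i : ℤ) + 2 * (j : ℤ))

/-- The shifted factorial `(α)_k = α (α + 1) ⋯ (α + k - 1)`, with `(α)_0 = 1`. -/
def shiftedFactorial (α : ℤ) (k : ℕ) : ℤ :=
  ∏ m ∈ Finset.range k, (α + (m : ℤ))

/-!
The entry in row `i` and column `j` of `A_n(x, y)` is the coefficient of `z ^ (x + 2j)` in
`(zⁱ - z⁻ⁱ) (1 + z) ^ (x + y + j)`. The row factors `zⁱ - z⁻ⁱ` span the same space, with a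
unitriangular change of basis, as `(z - z⁻¹) (z + 2 + z⁻¹) ^ (i - 1)`. In the new basis the entries
are differences of two consecutive binomial coefficients, hence single hypergeometric terms
`(x - y + 3j) (x + y + 2i + j - 1)! / ((y + i - j)! (x + i + 2j)!)` (`rowCoeff_mul_matrixA`).

For fixed `x` these terms are polynomials in `y`, so `y` may be taken real. Deleting the first row
of the new matrix replaces `(x, y)` by `(x + 1, y + 1)`, and deleting the first column replaces it
by `(x + 2, y - 1)`. The Desnanot–Jacobi identity (`det_mul_det_interior`) therefore expresses the
determinant of size `n + 2` through those of sizes `n + 1` and `n`. The product formula satisfies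
the same recurrence (`detValue_condensation`), and for irrational `y` it has no zero, so that the
division by the interior minor is legitimate and induction on the size applies. Both sides are
continuous in `y` and the irrationals are dense, which gives the formula for every real `y`
(`det_reducedMatrix`), in particular for natural numbers.
-/

/-! ### Rising factorials -/

/-- The rising factorial `a (a + 1) ⋯ (a + k - 1)` of a real number `a`. -/
noncomputable def rising (a : ℝ) (k : ℕ) : ℝ :=
  ∏ m ∈ Finset.range k, (a + m)

theorem rising_succ (a : ℝ) (k : ℕ) : rising a (k + 1) = rising a k * (a + k) :=
  Finset.prod_range_succ _ _

theorem rising_succ_left (a : ℝ) (k : ℕ) : rising a (k + 1) = a * rising (a + 1) k := by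
  rw [rising, Finset.prod_range_succ', mul_comm]
  simp only [rising, Nat.cast_zero, add_zero, Nat.cast_add, Nat.cast_one]
  congr 1
  exact Finset.prod_congr rfl fun m _ => by ring

theorem factorial_mul_rising (a k : ℕ) :
    (a.factorial : ℝ) * rising (a + 1) k = ((a + k).factorial : ℝ) := by
  induction k with
  | zero => simp [rising]
  | succ k ih =>
    rw [rising_succ, ← mul_assoc, ih, ← add_assoc, Nat.factorial_succ]
    push_cast
    ring

theorem cast_shiftedFactorial (a : ℤ) (k : ℕ) : (shiftedFactorial a k : ℝ) = rising a k := by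
  simp [shiftedFactorial, rising]

/-- The product `(z + 2) (z + 4) ⋯ (z + 2k)`. -/
noncomputable def evenShiftProd (z : ℝ) (k : ℕ) : ℝ :=
  ∏ j ∈ Finset.range k, (z + 2 * (j + 1))

theorem evenShiftProd_succ (z : ℝ) (k : ℕ) :
    evenShiftProd z (k + 1) = evenShiftProd z k * (z + 2 * (k + 1)) :=
  Finset.prod_range_succ _ _

theorem evenShiftProd_succ_left (z : ℝ) (k : ℕ) :
    evenShiftProd z (k + 1) = (z + 2) * evenShiftProd (z + 2) k := by
  rw [evenShiftProd, Finset.prod_range_succ', mul_comm]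
  simp only [evenShiftProd, Nat.cast_zero, Nat.cast_add, Nat.cast_one]
  congr 1
  · ring
  · exact Finset.prod_congr rfl fun m _ => by ring

theorem evenShiftProd_add_two (z : ℝ) (k : ℕ) :
    evenShiftProd (z + 2) k * (z + 2) = evenShiftProd z k * (z + 2 * (k + 1)) := by
  rw [← evenShiftProd_succ, evenShiftProd_succ_left, mul_comm]

theorem evenShiftProd_pos {z : ℝ} (hz : 0 ≤ z) (k : ℕ) : 0 < evenShiftProd z k :=
  Finset.prod_pos fun _ _ => by positivity

/-! ### The product formula and its condensation recurrence -/

/-- The quotient of the determinants of sizes `k + 1` and `k`, as a function of a real `y`. -/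
noncomputable def detRatio (x : ℕ) (y : ℝ) (k : ℕ) : ℝ :=
  k.factorial * rising (y + k + 1) (x + k + 2) * rising (x - y + 2 * k + 3) (k + 1) *
      evenShiftProd (x + 2 * y + k + 1) k /
    ((x + 3 * k + 3).factorial * evenShiftProd (x + k + 1) k)

/-- The value of the determinant of size `n`, as a polynomial function of a real `y`. -/
noncomputable def detValue (n x : ℕ) (y : ℝ) : ℝ :=
  ∏ k ∈ Finset.range n, detRatio x y k

theorem detValue_succ (n x : ℕ) (y : ℝ) :
    detValue (n + 1) x y = detValue n x y * detRatio x y n :=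
  Finset.prod_range_succ _ _

/-- The term in which `x` grows by `3` in the condensation recurrence, up to rational factors. -/
theorem detRatio_add_three (x : ℕ) (y : ℝ) (m : ℕ) :
    detRatio (x + 3) y m * ((m + 1) * (x - y + 2 * m + 5) * (x + 2 * y + m + 4)) =
      detRatio x y (m + 1) * ((x + y + 2 * m + 5) * (y + m + 1) * (x + m + 4)) := by
  have hP : (0 : ℝ) < evenShiftProd (x + m + 4) m := evenShiftProd_pos (by positivity) m
  have hG : (0 : ℝ) < (x + 3 * m + 6).factorial := by positivity
  have e1 : rising (y + m + 1) (x + m + 5) =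
      (y + m + 1) * (rising (y + m + 2) (x + m + 3) * (x + y + 2 * m + 5)) := by
    rw [rising_succ_left, rising_succ]
    push_cast
    ring_nf
  have e2 : rising (x - y + 2 * m + 5) (m + 2) =
      (x - y + 2 * m + 5) * rising (x - y + 2 * m + 6) (m + 1) := by
    rw [rising_succ_left]
    ring_nf
  have e3 : evenShiftProd (x + 2 * y + m + 2) (m + 1) =
      (x + 2 * y + m + 4) * evenShiftProd (x + 2 * y + m + 4) m := by
    rw [evenShiftProd_succ_left]
    ring_nf
  have e4 : evenShiftProd (x + m + 2) (m + 1) = (x + m + 4) * evenShiftProd (x + m + 4) m := by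
    rw [evenShiftProd_succ_left]
    ring_nf
  have h1 : detRatio (x + 3) y m =
      m.factorial * rising (y + m + 1) (x + m + 5) * rising (x - y + 2 * m + 6) (m + 1) *
        evenShiftProd (x + 2 * y + m + 4) m /
      ((x + 3 * m + 6).factorial * evenShiftProd (x + m + 4) m) := by
    rw [detRatio, show x + 3 + m + 2 = x + m + 5 by ring,
      show x + 3 + 3 * m + 3 = x + 3 * m + 6 by ring]
    push_cast
    ring_nf
  have h2 : detRatio x y (m + 1) =
      ((m + 1) * m.factorial) * rising (y + m + 2) (x + m + 3) *
        rising (x - y + 2 * m + 5) (m + 2) * evenShiftProd (x + 2 * y + m + 2) (m + 1) /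
      ((x + 3 * m + 6).factorial * evenShiftProd (x + m + 2) (m + 1)) := by
    rw [detRatio, show x + (m + 1) + 2 = x + m + 3 by ring,
      show x + 3 * (m + 1) + 3 = x + 3 * m + 6 by ring, Nat.factorial_succ]
    push_cast
    ring_nf
  rw [h1, h2, e1, e2, e3, e4]
  have hx : (0 : ℝ) < x + m + 4 := by positivity
  field_simp

set_option maxHeartbeats 1600000 in
/-- The induction step for `detValue_cross`. -/
theorem detRatio_cross (x : ℕ) (y : ℝ) (k : ℕ) :
    detRatio (x + 1) (y + 1) k * detRatio (x + 2) (y - 1) k *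
        ((x + y + 2 * k + 5) * (y + k + 1) * (x + 3 * k + 3) * (x + k + 4)) =
      detRatio x y k * detRatio (x + 3) y k *
        ((x + y + 2 * k + 3) * (y + k) * (x + k + 3) * (x + 3 * k + 6)) := by
  set S := rising (y + k + 2) (x + k + 1) with hS
  have a0 : rising (y + k + 1) (x + k + 2) = (y + k + 1) * S := by
    rw [rising_succ_left, hS]
    ring_nf
  have a1 : rising (y + k + 2) (x + k + 3) = S * (x + y + 2 * k + 3) * (x + y + 2 * k + 4) := by
    rw [rising_succ, rising_succ, hS]
    push_cast
    ring
  have a2 : rising (y + k) (x + k + 4) = (y + k) * ((y + k + 1) * (S * (x + y + 2 * k + 3))) := by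
    rw [rising_succ_left, rising_succ_left, rising_succ, hS]
    push_cast
    ring_nf
  have a3 : rising (y + k + 1) (x + k + 5) =
      (y + k + 1) * (S * (x + y + 2 * k + 3) * (x + y + 2 * k + 4) * (x + y + 2 * k + 5)) := by
    rw [rising_succ_left, rising_succ, rising_succ, rising_succ, hS]
    push_cast
    ring_nf
  set G : ℝ := ((x + 3 * k + 3).factorial : ℝ) with hG
  have g1 : ((x + 3 * k + 4).factorial : ℝ) = (x + 3 * k + 4) * G := by
    rw [Nat.factorial_succ]; push_cast; ring
  have g2 : ((x + 3 * k + 5).factorial : ℝ) = (x + 3 * k + 5) * ((x + 3 * k + 4) * G) := by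
    rw [Nat.factorial_succ, Nat.factorial_succ]; push_cast; ring
  have g3 : ((x + 3 * k + 6).factorial : ℝ) =
      (x + 3 * k + 6) * ((x + 3 * k + 5) * ((x + 3 * k + 4) * G)) := by
    rw [Nat.factorial_succ, Nat.factorial_succ, Nat.factorial_succ]; push_cast; ring
  have p0 : evenShiftProd (x + k + 1) k ≠ 0 := (evenShiftProd_pos (by positivity) k).ne'
  have p1 : evenShiftProd (x + k + 2) k ≠ 0 := (evenShiftProd_pos (by positivity) k).ne'
  have d2 : evenShiftProd (x + k + 3) k =
      evenShiftProd (x + k + 1) k * (x + 3 * k + 3) / (x + k + 3) := by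
    have := evenShiftProd_add_two (x + k + 1) k
    rw [show (x : ℝ) + k + 1 + 2 = x + k + 3 by ring] at this
    rw [eq_div_iff (by positivity), this]
    ring
  have d3 : evenShiftProd (x + k + 4) k =
      evenShiftProd (x + k + 2) k * (x + 3 * k + 4) / (x + k + 4) := by
    have := evenShiftProd_add_two (x + k + 2) k
    rw [show (x : ℝ) + k + 2 + 2 = x + k + 4 by ring] at this
    rw [eq_div_iff (by positivity), this]
    ring
  have h0 : detRatio x y k = k.factorial * ((y + k + 1) * S) * rising (x - y + 2 * k + 3) (k + 1) *
      evenShiftProd (x + 2 * y + k + 1) k / (G * evenShiftProd (x + k + 1) k) := by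
    rw [detRatio, a0]
  have h1 : detRatio (x + 1) (y + 1) k =
      k.factorial * rising (y + k + 2) (x + k + 3) * rising (x - y + 2 * k + 3) (k + 1) *
        evenShiftProd (x + 2 * y + k + 4) k /
          ((x + 3 * k + 4).factorial * evenShiftProd (x + k + 2) k) := by
    rw [detRatio, show x + 1 + k + 2 = x + k + 3 by ring,
      show x + 1 + 3 * k + 3 = x + 3 * k + 4 by ring]
    push_cast
    ring_nf
  have h2 : detRatio (x + 2) (y - 1) k =
      k.factorial * rising (y + k) (x + k + 4) * rising (x - y + 2 * k + 6) (k + 1) *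
        evenShiftProd (x + 2 * y + k + 1) k /
          ((x + 3 * k + 5).factorial * evenShiftProd (x + k + 3) k) := by
    rw [detRatio, show x + 2 + k + 2 = x + k + 4 by ring,
      show x + 2 + 3 * k + 3 = x + 3 * k + 5 by ring]
    push_cast
    ring_nf
  have h3 : detRatio (x + 3) y k =
      k.factorial * rising (y + k + 1) (x + k + 5) * rising (x - y + 2 * k + 6) (k + 1) *
        evenShiftProd (x + 2 * y + k + 4) k /
          ((x + 3 * k + 6).factorial * evenShiftProd (x + k + 4) k) := by
    rw [detRatio, show x + 3 + k + 2 = x + k + 5 by ring,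
      show x + 3 + 3 * k + 3 = x + 3 * k + 6 by ring]
    push_cast
    ring_nf
  rw [h0, h1, h2, h3, a1, a2, a3, g1, g2, g3, d2, d3]
  have hG0 : G ≠ 0 := by positivity
  have hB3 : (x : ℝ) + 3 * k + 3 ≠ 0 := by positivity
  have hB4 : (x : ℝ) + 3 * k + 4 ≠ 0 := by positivity
  have hB5 : (x : ℝ) + 3 * k + 5 ≠ 0 := by positivity
  have hB6 : (x : ℝ) + 3 * k + 6 ≠ 0 := by positivity
  have hE3 : (x : ℝ) + k + 3 ≠ 0 := by positivity
  have hE4 : (x : ℝ) + k + 4 ≠ 0 := by positivity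
  -- both sides are monomials in the following quantities
  clear_value G S
  generalize evenShiftProd (x + k + 1) k = d0 at p0 ⊢
  generalize evenShiftProd (x + k + 2) k = d1 at p1 ⊢
  generalize evenShiftProd (x + 2 * y + k + 1) k = u
  generalize evenShiftProd (x + 2 * y + k + 4) k = v
  generalize rising (x - y + 2 * k + 3) (k + 1) = s
  generalize rising (x - y + 2 * k + 6) (k + 1) = t
  generalize (x : ℝ) + 3 * k + 3 = B3 at hB3 ⊢
  generalize (x : ℝ) + 3 * k + 4 = B4 at hB4 ⊢
  generalize (x : ℝ) + 3 * k + 5 = B5 at hB5 ⊢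
  generalize (x : ℝ) + 3 * k + 6 = B6 at hB6 ⊢
  generalize (x : ℝ) + k + 3 = E3 at hE3 ⊢
  generalize (x : ℝ) + k + 4 = E4 at hE4 ⊢
  generalize y + k + 1 = c1
  generalize y + k = c0
  generalize (x : ℝ) + y + 2 * k + 3 = A3
  generalize (x : ℝ) + y + 2 * k + 4 = A4
  generalize (x : ℝ) + y + 2 * k + 5 = A5
  field_simp

theorem irrational_ne {y : ℝ} (hy : Irrational y) {a b : ℤ} (hb : b ≠ 0) : (a : ℝ) + b * y ≠ 0 :=
  ((hy.intCast_mul hb).intCast_add a).ne_zero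

/-- The two products subtracted from one another in the condensation recurrence have a rational
function as quotient. -/
theorem detValue_cross {y : ℝ} (hy : Irrational y) (m x : ℕ) :
    detValue m (x + 1) (y + 1) * detValue m (x + 2) (y - 1) *
        ((x + y + 2 * m + 3) * (y + m) * (x + m + 3)) =
      detValue m x y * detValue m (x + 3) y * (y * (x + 3 * m + 3) * (x + y + 3)) := by
  induction m with
  | zero => simp [detValue]; ring
  | succ m ih =>
    have h1 : (x : ℝ) + y + 2 * m + 3 ≠ 0 := by
      have := irrational_ne hy (a := x + 2 * m + 3) (b := 1) one_ne_zero
      push_cast at this; intro h; apply this; linarith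
    have h2 : y + m ≠ 0 := by
      have := irrational_ne hy (a := m) (b := 1) one_ne_zero
      push_cast at this; intro h; apply this; linarith
    have h3 : (x : ℝ) + m + 3 ≠ 0 := by positivity
    have h4 : (x : ℝ) + 3 * m + 3 ≠ 0 := by positivity
    have hc := detRatio_cross x y m
    simp only [detValue_succ]
    push_cast
    apply mul_right_cancel₀ (mul_ne_zero (mul_ne_zero (mul_ne_zero h1 h2) h3) h4)
    linear_combination (detRatio (x + 1) (y + 1) m * detRatio (x + 2) (y - 1) m *
      ((x + y + 2 * m + 5) * (y + m + 1) * (x + 3 * m + 3) * (x + m + 4))) * ih +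
      (detValue m x y * detValue m (x + 3) y * (y * (x + 3 * m + 3) * (x + y + 3))) * hc

theorem detValue_condensation {y : ℝ} (hy : Irrational y) (m x : ℕ) :
    detValue (m + 2) x y * detValue m (x + 3) y =
      detValue (m + 1) x y * detValue (m + 1) (x + 3) y -
        detValue (m + 1) (x + 1) (y + 1) * detValue (m + 1) (x + 2) (y - 1) := by
  have h1 : (x : ℝ) + y + 2 * m + 5 ≠ 0 := by
    have := irrational_ne hy (a := x + 2 * m + 5) (b := 1) one_ne_zero
    push_cast at this; intro h; apply this; linarith
  have h2 : y + m + 1 ≠ 0 := by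
    have := irrational_ne hy (a := m + 1) (b := 1) one_ne_zero
    push_cast at this; intro h; apply this; linarith
  have h3 : (x : ℝ) + m + 4 ≠ 0 := by positivity
  have hQ := detValue_cross hy (m + 1) x
  have hR := detRatio_add_three x y m
  have e1 := detValue_succ (m + 1) x y
  have e2 := detValue_succ m (x + 3) y
  apply mul_right_cancel₀ (mul_ne_zero (mul_ne_zero h1 h2) h3)
  push_cast at hQ
  rw [sub_mul]
  rw [show (x : ℝ) + y + 2 * m + 5 = x + y + 2 * (m + 1) + 3 by ring,
    show y + m + 1 = y + (m + 1) by ring, show (x : ℝ) + m + 4 = x + (m + 1) + 3 by ring, hQ, e1,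
    e2]
  linear_combination -(detValue (m + 1) x y * detValue m (x + 3) y) * hR

theorem detValue_ne_zero {y : ℝ} (hy : Irrational y) (n x : ℕ) : detValue n x y ≠ 0 := by
  refine Finset.prod_ne_zero_iff.2 fun k _ => div_ne_zero (mul_ne_zero (mul_ne_zero (mul_ne_zero
    (by positivity) ?_) ?_) ?_) ?_
  · refine Finset.prod_ne_zero_iff.2 fun m _ => ?_
    have := irrational_ne hy (a := k + 1 + m) (b := 1) one_ne_zero
    push_cast at this; intro h; apply this; linarith
  · refine Finset.prod_ne_zero_iff.2 fun m _ => ?_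
    have := irrational_ne hy (a := x + 2 * k + 3 + m) (b := -1) (by norm_num)
    push_cast at this; intro h; apply this; linarith
  · refine Finset.prod_ne_zero_iff.2 fun m _ => ?_
    have := irrational_ne hy (a := x + k + 1 + 2 * (m + 1)) (b := 2) (by norm_num)
    push_cast at this; intro h; apply this; linarith
  · have := evenShiftProd_pos (z := x + k + 1) (by positivity) k
    positivity

theorem continuous_detValue (n x : ℕ) : Continuous (detValue n x) := by
  unfold detValue detRatio evenShiftProd rising
  fun_prop

/-- The successive quotients in `n` of the product on the right are the factors of `detValue`. -/
theorem detValue_natCast (n x y : ℕ) :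
    detValue n x y = ∏ j ∈ Finset.Icc 1 n,
        (((j - 1).factorial : ℝ) * ((x + y + 2 * j).factorial : ℝ) *
            rising (x - y + 2 * j + 1) j * rising (x + 2 * y + 3 * j + 1) (n - j)) /
          (((x + n + 2 * j).factorial : ℝ) * ((y + n - j).factorial : ℝ)) := by
  have hrange : ∀ N : ℕ, (∏ j ∈ Finset.Icc 1 N,
        (((j - 1).factorial : ℝ) * ((x + y + 2 * j).factorial : ℝ) *
            rising (x - y + 2 * j + 1) j * rising (x + 2 * y + 3 * j + 1) (N - j)) /
          (((x + N + 2 * j).factorial : ℝ) * ((y + N - j).factorial : ℝ))) =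
      ∏ j ∈ Finset.range N, ((j.factorial : ℝ) * ((x + y + 2 * j + 2).factorial : ℝ) *
            rising (x - y + 2 * j + 3) (j + 1) * rising (x + 2 * y + 3 * j + 4) (N - (j + 1))) /
          (((x + N + 2 * j + 2).factorial : ℝ) * ((y + N - (j + 1)).factorial : ℝ)) := by
    intro N
    refine Finset.prod_nbij' (· - 1) (· + 1) (fun j hj => ?_) (fun j hj => ?_) (fun j hj => ?_)
      (fun j _ => by simp) fun j hj => ?_
    · have := Finset.mem_Icc.1 hj
      exact Finset.mem_range.2 (by omega)
    · have := Finset.mem_range.1 hj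
      exact Finset.mem_Icc.2 (by omega)
    · exact Nat.sub_add_cancel (Finset.mem_Icc.1 hj).1
    · obtain ⟨d, rfl⟩ := Nat.exists_eq_add_of_le' (Finset.mem_Icc.1 hj).1
      rw [Nat.add_sub_cancel, show x + y + 2 * (d + 1) = x + y + 2 * d + 2 by ring,
        show x + N + 2 * (d + 1) = x + N + 2 * d + 2 by ring]
      push_cast
      rw [show (x : ℝ) - y + 2 * (d + 1) + 1 = x - y + 2 * d + 3 by ring,
        show (x : ℝ) + 2 * y + 3 * (d + 1) + 1 = x + 2 * y + 3 * d + 4 by ring]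
  rw [hrange]
  induction n with
  | zero => simp [detValue]
  | succ n ih =>
    rw [detValue_succ, ih, Finset.prod_range_succ]
    -- the effect on a single factor of raising `n` by one
    have hstep : ∀ j ∈ Finset.range n,
        ((j.factorial : ℝ) * ((x + y + 2 * j + 2).factorial : ℝ) *
            rising (x - y + 2 * j + 3) (j + 1) *
            rising (x + 2 * y + 3 * j + 4) (n + 1 - (j + 1))) /
          (((x + (n + 1) + 2 * j + 2).factorial : ℝ) *
            ((y + (n + 1) - (j + 1)).factorial : ℝ)) =
        ((j.factorial : ℝ) * ((x + y + 2 * j + 2).factorial : ℝ) *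
            rising (x - y + 2 * j + 3) (j + 1) * rising (x + 2 * y + 3 * j + 4) (n - (j + 1))) /
          (((x + n + 2 * j + 2).factorial : ℝ) * ((y + n - (j + 1)).factorial : ℝ)) *
        ((x + 2 * y + n + 1 + 2 * (j + 1)) / (x + n + 1 + 2 * (j + 1)) /
          (y + 1 + (n - 1 - j : ℕ))) := by
      intro j hj
      obtain ⟨d, rfl⟩ := Nat.exists_eq_add_of_lt (Finset.mem_range.1 hj)
      rw [show j + d + 1 + 1 - (j + 1) = d + 1 by omega, show j + d + 1 - (j + 1) = d by omega,
        show y + (j + d + 1 + 1) - (j + 1) = y + d + 1 by omega,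
        show y + (j + d + 1) - (j + 1) = y + d by omega,
        show j + d + 1 - 1 - j = d by omega,
        show x + (j + d + 1 + 1) + 2 * j + 2 = x + (j + d + 1) + 2 * j + 2 + 1 by ring,
        rising_succ _ d, Nat.factorial_succ (y + d), Nat.factorial_succ (x + (j + d + 1) + 2 * j + 2)]
      push_cast
      field_simp
      ring
    rw [Finset.prod_congr rfl hstep, Finset.prod_mul_distrib, mul_assoc]
    congr 1
    rw [Finset.prod_div_distrib, Finset.prod_div_distrib,
      Finset.prod_range_reflect (fun i => (y : ℝ) + 1 + (i : ℕ)) n]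
    have hy1 : ∏ i ∈ Finset.range n, ((y : ℝ) + 1 + (i : ℕ)) = rising (y + 1) n := rfl
    have hy2 := factorial_mul_rising y n
    have hy3 := factorial_mul_rising (y + n) (x + n + 2)
    push_cast at hy3
    rw [hy1, eq_div_of_mul_eq (by positivity) ((mul_comm _ _).trans hy2), detRatio,
      eq_div_of_mul_eq (by positivity) ((mul_comm _ _).trans hy3)]
    have hd := evenShiftProd_pos (z := x + n + 1) (by positivity) n
    rw [show n + 1 - (n + 1) = 0 by omega, show y + (n + 1) - (n + 1) = y by omega,
      show x + (n + 1) + 2 * n + 2 = x + 3 * n + 3 by ring,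
      show y + n + (x + n + 2) = x + y + 2 * n + 2 by ring]
    change _ = evenShiftProd (x + 2 * y + n + 1) n / evenShiftProd (x + n + 1) n / _ * _
    simp only [rising, Finset.prod_range_zero]
    field_simp

/-! ### Dodgson condensation -/

/-- All minors that border the block indexed by `f` are, up to the factor `det` of this block, minors
of a single matrix, the Schur complement of the block. -/
theorem det_submatrix_sumElim {K ι κ m : Type*} [Field K] [Fintype κ] [DecidableEq κ]
    [Fintype m] [DecidableEq m] (M : Matrix ι ι K) (f : κ → ι)
    (h : (M.submatrix f f).det ≠ 0) (g g' : m → ι) :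
    (M.submatrix (Sum.elim f g) (Sum.elim f g')).det =
      (M.submatrix f f).det *
        ((M - M.submatrix id f * (M.submatrix f f)⁻¹ * M.submatrix f id).submatrix g g').det := by
  have := Matrix.invertibleOfIsUnitDet _ (isUnit_iff_ne_zero.2 h)
  have e : M.submatrix (Sum.elim f g) (Sum.elim f g') =
      Matrix.fromBlocks (M.submatrix f f) (M.submatrix f g') (M.submatrix g f)
        (M.submatrix g g') := by
    ext (i | i) (j | j) <;> rfl
  rw [e, Matrix.det_fromBlocks₁₁, Matrix.invOf_eq_nonsing_inv]
  rfl

/-- Reindexing rows and columns differently changes a determinant by a sign; the signs cancel when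
the two reindexings are exchanged in a second determinant. -/
theorem det_submatrix_mul_det_submatrix {R m n : Type*} [CommRing R] [Fintype m] [DecidableEq m]
    [Fintype n] [DecidableEq n] (A B : Matrix n n R) (e e' : m ≃ n) :
    (A.submatrix e e').det * (B.submatrix e' e).det = A.det * B.det := by
  have key : ∀ (N : Matrix n n R) (u v : m ≃ n),
      (N.submatrix u v).det = Equiv.Perm.sign (u.symm.trans v) * N.det := by
    intro N u v
    rw [← Matrix.det_permute', ← Matrix.det_submatrix_equiv_self u (N.submatrix _ _),
      Matrix.submatrix_submatrix]
    congr 2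
    ext i
    simp
  have hs : Equiv.Perm.sign (e'.symm.trans e) = Equiv.Perm.sign (e.symm.trans e') := by
    rw [← Equiv.Perm.sign_symm]
    rfl
  rw [key, key, hs, mul_mul_mul_comm, ← Int.cast_mul, ← Units.val_mul, Int.units_mul_self]
  simp

/-- The Desnanot–Jacobi identity (Dodgson condensation) for a matrix with invertible interior. -/
theorem det_mul_det_interior {K : Type*} [Field K] {n : ℕ}
    (M : Matrix (Fin (n + 2)) (Fin (n + 2)) K)
    (h : (M.submatrix (fun i : Fin n => i.succ.castSucc) fun i => i.succ.castSucc).det ≠ 0) :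
    M.det * (M.submatrix (fun i : Fin n => i.succ.castSucc) fun i => i.succ.castSucc).det =
      (M.submatrix Fin.castSucc Fin.castSucc).det * (M.submatrix Fin.succ Fin.succ).det -
        (M.submatrix Fin.castSucc Fin.succ).det * (M.submatrix Fin.succ Fin.castSucc).det := by
  set f : Fin n → Fin (n + 2) := fun i => i.succ.castSucc with hf
  have hfi : Function.Injective f := fun i j hij =>
    Fin.succ_injective _ (Fin.castSucc_injective _ hij)
  have hb : Function.Bijective (Sum.elim f ![0, Fin.last (n + 1)]) := by
    refine (Fintype.bijective_iff_injective_and_card _).2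
      ⟨hfi.sumElim ?_ ?_, by simp⟩
    · intro a b
      fin_cases a <;> fin_cases b <;> simp [Fin.ext_iff]
    · intro i b
      fin_cases b <;> simp [hf, Fin.ext_iff]
      omega
  have hb₁ : Function.Bijective (Sum.elim (Fin.succ : Fin n → Fin (n + 1)) fun _ : Fin 1 => 0) := by
    refine (Fintype.bijective_iff_injective_and_card _).2
      ⟨(Fin.succ_injective _).sumElim (Function.injective_of_subsingleton _) ?_, by simp⟩
    intro i b
    exact Fin.succ_ne_zero i
  have hb₂ : Function.Bijective
      (Sum.elim (Fin.castSucc : Fin n → Fin (n + 1)) fun _ : Fin 1 => Fin.last n) := by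
    refine (Fintype.bijective_iff_injective_and_card _).2
      ⟨(Fin.castSucc_injective _).sumElim (Function.injective_of_subsingleton _) ?_, by simp⟩
    intro i b
    exact (Fin.castSucc_lt_last i).ne
  have c₁ : Fin.castSucc ∘ Equiv.ofBijective _ hb₁ = Sum.elim f fun _ => 0 := by
    ext (i | i) <;> simp [hf]
  have c₂ : Fin.succ ∘ Equiv.ofBijective _ hb₂ = Sum.elim f fun _ => Fin.last (n + 1) := by
    ext (i | i) <;> simp [hf]
  rw [← det_submatrix_mul_det_submatrix (M.submatrix Fin.castSucc Fin.succ)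
      (M.submatrix Fin.succ Fin.castSucc) (Equiv.ofBijective _ hb₁) (Equiv.ofBijective _ hb₂),
    ← Matrix.det_submatrix_equiv_self (Equiv.ofBijective _ hb₁)
      (M.submatrix Fin.castSucc Fin.castSucc),
    ← Matrix.det_submatrix_equiv_self (Equiv.ofBijective _ hb₂) (M.submatrix Fin.succ Fin.succ),
    ← Matrix.det_submatrix_equiv_self (Equiv.ofBijective _ hb) M]
  simp only [Matrix.submatrix_submatrix, c₁, c₂]
  rw [show ⇑(Equiv.ofBijective _ hb) = Sum.elim f ![0, Fin.last (n + 1)] from rfl]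
  simp only [det_submatrix_sumElim M f h, Matrix.det_fin_two, Matrix.det_unique,
    Matrix.submatrix_apply, Matrix.cons_val_zero, Matrix.cons_val_one]
  ring

/-! ### The hypergeometric determinant -/

/-- The matrix `A_n(x, y)` after row operations, as a polynomial function of a real `y`.
As for `matrixA`, the index `a` stands for `i = a + 1`, and `b` for `j = b + 1`. -/
noncomputable def reducedMatrix (n x : ℕ) (y : ℝ) : Matrix (Fin n) (Fin n) ℝ :=
  Matrix.of fun a b =>
    (x - y + 3 * (b + 1)) * rising (y + a - b + 1) (x + a + 2 * b + 2) /
      (x + a + 2 * b + 3).factorial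

theorem det_reducedMatrix_of_irrational (n : ℕ) :
    ∀ (x : ℕ) {y : ℝ}, Irrational y → (reducedMatrix n x y).det = detValue n x y := by
  induction n using Nat.twoStepInduction with
  | zero => intro x y _; simp [detValue]
  | one =>
    intro x y _
    rw [Matrix.det_unique, detValue_succ]
    simp [reducedMatrix, detValue, detRatio, evenShiftProd, rising]
    ring
  | more n ih₀ ih₁ =>
    intro x y hy
    have hint : (reducedMatrix (n + 2) x y).submatrix
        (fun i : Fin n => i.succ.castSucc) (fun i => i.succ.castSucc) =
        reducedMatrix n (x + 3) y := by
      ext a b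
      simp only [reducedMatrix, Matrix.submatrix_apply, Matrix.of_apply, Fin.val_castSucc,
        Fin.val_succ]
      rw [show x + (a + 1) + 2 * (b + 1 : ℕ) + 2 = x + 3 + a + 2 * b + 2 by ring,
        show x + (a + 1) + 2 * (b + 1 : ℕ) + 3 = x + 3 + a + 2 * b + 3 by ring]
      push_cast
      ring_nf
    have hcc : (reducedMatrix (n + 2) x y).submatrix Fin.castSucc Fin.castSucc =
        reducedMatrix (n + 1) x y := rfl
    have hss : (reducedMatrix (n + 2) x y).submatrix Fin.succ Fin.succ =
        reducedMatrix (n + 1) (x + 3) y := by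
      ext a b
      simp only [reducedMatrix, Matrix.submatrix_apply, Matrix.of_apply, Fin.val_succ]
      rw [show x + (a + 1) + 2 * (b + 1 : ℕ) + 2 = x + 3 + a + 2 * b + 2 by ring,
        show x + (a + 1) + 2 * (b + 1 : ℕ) + 3 = x + 3 + a + 2 * b + 3 by ring]
      push_cast
      ring_nf
    have hcs : (reducedMatrix (n + 2) x y).submatrix Fin.castSucc Fin.succ =
        reducedMatrix (n + 1) (x + 2) (y - 1) := by
      ext a b
      simp only [reducedMatrix, Matrix.submatrix_apply, Matrix.of_apply, Fin.val_succ,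
        Fin.val_castSucc]
      rw [show x + a + 2 * (b + 1 : ℕ) + 2 = x + 2 + a + 2 * b + 2 by ring,
        show x + a + 2 * (b + 1 : ℕ) + 3 = x + 2 + a + 2 * b + 3 by ring]
      push_cast
      ring_nf
    have hsc : (reducedMatrix (n + 2) x y).submatrix Fin.succ Fin.castSucc =
        reducedMatrix (n + 1) (x + 1) (y + 1) := by
      ext a b
      simp only [reducedMatrix, Matrix.submatrix_apply, Matrix.of_apply, Fin.val_succ,
        Fin.val_castSucc]
      rw [show x + (a + 1) + 2 * (b : ℕ) + 2 = x + 1 + a + 2 * b + 2 by ring,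
        show x + (a + 1) + 2 * (b : ℕ) + 3 = x + 1 + a + 2 * b + 3 by ring]
      push_cast
      ring_nf
    have hne : (reducedMatrix n (x + 3) y).det ≠ 0 := by
      rw [ih₀ _ hy]
      exact detValue_ne_zero hy n _
    have hDJ := det_mul_det_interior (reducedMatrix (n + 2) x y) (by rwa [hint])
    rw [hint, hcc, hss, hcs, hsc] at hDJ
    have hadd : Irrational (y + 1) := by simpa using hy.add_natCast 1
    have hsub : Irrational (y - 1) := by simpa using hy.sub_natCast 1
    apply mul_right_cancel₀ hne
    rw [hDJ, ih₁ _ hy, ih₁ _ hy, ih₁ _ hadd, ih₁ _ hsub, ih₀ _ hy, detValue_condensation hy]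
    ring

theorem det_reducedMatrix (n x : ℕ) (y : ℝ) :
    (reducedMatrix n x y).det = detValue n x y := by
  have hc : Continuous fun y => (reducedMatrix n x y).det := by
    refine Continuous.matrix_det (continuous_matrix fun a b => ?_)
    unfold reducedMatrix rising
    simp only [Matrix.of_apply]
    fun_prop
  exact congrFun (Continuous.ext_on dense_irrational hc (continuous_detValue n x)
    fun y hy => det_reducedMatrix_of_irrational n x hy) y

/-! ### Row reduction of the binomial matrix -/

theorem intBinom_natCast (m k : ℕ) : intBinom m k = m.choose k := by
  simp [intBinom]

theorem intBinom_succ (m : ℕ) (k : ℤ) :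
    intBinom (m + 1) k = intBinom m k + intBinom m (k - 1) := by
  rcases lt_trichotomy k 0 with h | rfl | h
  · simp [intBinom, not_le.2 h, show ¬ (1 ≤ k) by omega]
  · simp [intBinom]
  · obtain ⟨d, rfl⟩ := Int.eq_ofNat_of_zero_le (show 0 ≤ k - 1 by omega) |>.imp
      fun d hd => show k = (d + 1 : ℕ) by push_cast; omega
    rw [show ((d + 1 : ℕ) : ℤ) - 1 = (d : ℕ) by push_cast; ring]
    simp only [intBinom_natCast]
    rw [Nat.choose_succ_succ]
    push_cast
    ring

/-- The coefficients in
`(z - z⁻¹) (z + 2 + z⁻¹) ^ i = ∑ l, rowCoeff i l * (z ^ (l + 1) - z ^ (-l - 1))`. -/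
def rowCoeff : ℕ → ℕ → ℤ
  | 0, l => if l = 0 then 1 else 0
  | i + 1, 0 => 2 * rowCoeff i 0 + rowCoeff i 1
  | i + 1, l + 1 => rowCoeff i l + 2 * rowCoeff i (l + 1) + rowCoeff i (l + 2)

theorem rowCoeff_eq_zero {i l : ℕ} (h : i < l) : rowCoeff i l = 0 := by
  induction i generalizing l with
  | zero => simp [rowCoeff, h.ne']
  | succ i ih =>
    obtain ⟨l, rfl⟩ := Nat.exists_eq_succ_of_ne_zero (Nat.ne_zero_of_lt h)
    simp [rowCoeff, ih (show i < l by omega), ih (show i < l + 1 by omega),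
      ih (show i < l + 2 by omega)]

theorem rowCoeff_self (i : ℕ) : rowCoeff i i = 1 := by
  induction i with
  | zero => rfl
  | succ i ih => simp [rowCoeff, ih, rowCoeff_eq_zero]

theorem det_rowCoeff (n : ℕ) :
    (Matrix.of fun a b : Fin n => rowCoeff a b).det = 1 := by
  rw [Matrix.det_of_isLowerTriangular]
  · simp [rowCoeff_self]
  · intro a b h
    exact rowCoeff_eq_zero h

/-- The recurrence of `rowCoeff`, moved to the sequence `v` by summation by parts. -/
theorem sum_rowCoeff_succ (i m : ℕ) (v : ℕ → ℤ) (hv : v 0 = 0) :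
    ∑ l ∈ Finset.range (m + 1), rowCoeff (i + 1) l * v (l + 1) =
      ∑ l ∈ Finset.range (m + 1), rowCoeff i l * (v l + 2 * v (l + 1) + v (l + 2)) -
        rowCoeff i m * v (m + 2) + rowCoeff i (m + 1) * v (m + 1) := by
  induction m with
  | zero => simp [rowCoeff, hv]; ring
  | succ m ih =>
    rw [Finset.sum_range_succ, ih, Finset.sum_range_succ _ (m + 1), rowCoeff]
    ring

/-- Two expressions for the coefficient of `z ^ k` in `(z - z⁻¹) (z + 2 + z⁻¹) ^ i (1 + z) ^ N`:
the left one expands the first two factors by `rowCoeff`, the right one uses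
`z + 2 + z⁻¹ = z⁻¹ (1 + z) ^ 2` and `z - z⁻¹ = z⁻¹ (z - 1) (1 + z)`. -/
theorem sum_rowCoeff_mul (n i N : ℕ) (hi : i < n) (k : ℤ) :
    ∑ l ∈ Finset.range n,
        rowCoeff i l * (intBinom N (k - (l + 1 : ℕ)) - intBinom N (k + (l + 1 : ℕ))) =
      intBinom (N + 2 * i + 1) (k + i) - intBinom (N + 2 * i + 1) (k + i + 1) := by
  induction i generalizing k with
  | zero =>
    rw [Finset.sum_eq_single_of_mem 0 (Finset.mem_range.2 hi)
      fun l _ hl => by simp [rowCoeff, hl]]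
    simp only [rowCoeff, intBinom_succ, mul_zero, add_zero, Nat.cast_zero]
    push_cast
    ring_nf
  | succ i ih =>
    obtain ⟨m, rfl⟩ := Nat.exists_eq_succ_of_ne_zero (Nat.ne_zero_of_lt hi)
    have hi' : i < m := by omega
    have h := sum_rowCoeff_succ i m (fun l => intBinom N (k - (l : ℕ)) - intBinom N (k + (l : ℕ)))
      (by simp)
    rw [rowCoeff_eq_zero hi', rowCoeff_eq_zero (hi'.trans (Nat.lt_succ_self m)), zero_mul,
      zero_mul, sub_zero, add_zero] at h
    rw [Nat.succ_eq_add_one, h]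
    -- multiplication by `z + z⁻¹` shifts the row index `l` and the column index `k` alike
    have hsplit : ∀ l : ℕ,
        (intBinom N (k - (l : ℕ)) - intBinom N (k + (l : ℕ))) +
          2 * (intBinom N (k - (l + 1 : ℕ)) - intBinom N (k + (l + 1 : ℕ))) +
          (intBinom N (k - (l + 2 : ℕ)) - intBinom N (k + (l + 2 : ℕ))) =
        (intBinom N (k + 1 - (l + 1 : ℕ)) - intBinom N (k + 1 + (l + 1 : ℕ))) +
          2 * (intBinom N (k - (l + 1 : ℕ)) - intBinom N (k + (l + 1 : ℕ))) +
          (intBinom N (k - 1 - (l + 1 : ℕ)) - intBinom N (k - 1 + (l + 1 : ℕ))) := by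
      intro l
      push_cast
      ring_nf
    simp only [hsplit, mul_add, Finset.sum_add_distrib, mul_left_comm _ (2 : ℤ),
      ← Finset.mul_sum]
    simp only [← mul_add, ← Nat.succ_eq_add_one m]
    rw [ih (by omega), ih (by omega), ih (by omega),
      show N + 2 * (i + 1) + 1 = N + 2 * i + 1 + 1 + 1 by ring]
    simp only [intBinom_succ (N + 2 * i + 1 + 1), intBinom_succ (N + 2 * i + 1)]
    push_cast
    ring_nf

theorem cast_choose_eq_rising (m k : ℕ) :
    (m.choose k : ℝ) = rising (m - k + 1) k / k.factorial := by
  induction k with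
  | zero => simp [rising]
  | succ k ih =>
    have h : (m.choose (k + 1) : ℝ) * (k + 1) = m.choose k * (m - k) := by
      rcases le_or_gt k m with hk | hk
      · have := Nat.choose_succ_right_eq m k
        rw [← Nat.cast_sub hk]
        exact_mod_cast this
      · simp [Nat.choose_eq_zero_of_lt hk, Nat.choose_eq_zero_of_lt (hk.trans k.lt_succ_self)]
    rw [eq_div_of_mul_eq (by positivity) h, ih, Nat.factorial_succ, rising_succ_left]
    push_cast
    rw [show (m : ℝ) - (k + 1) + 1 = m - k by ring]
    field_simp

theorem choose_sub_choose_succ (m k : ℕ) :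
    (m.choose k : ℝ) - m.choose (k + 1) =
      (2 * k + 1 - m) * rising (m - k + 1) k / (k + 1).factorial := by
  rw [cast_choose_eq_rising, cast_choose_eq_rising, Nat.factorial_succ, rising_succ_left]
  push_cast
  rw [show (m : ℝ) - (k + 1) + 1 = m - k by ring]
  field_simp
  ring

theorem rowCoeff_mul_matrixA (n x y : ℕ) :
    ((Matrix.of fun a b : Fin n => rowCoeff a b) * matrixA n x y).map (Int.cast : ℤ → ℝ) =
      reducedMatrix n x y := by
  ext a b
  have h := sum_rowCoeff_mul n a (x + y + (b + 1)) a.isLt (x + 2 * (b + 1))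
  have e : ((x : ℤ) + 2 * (b + 1)) + (a : ℕ) = ((x + a + 2 * b + 2 : ℕ) : ℤ) := by
    push_cast
    ring
  rw [e, ← Nat.cast_succ (x + a + 2 * b + 2), intBinom_natCast, intBinom_natCast,
    Finset.sum_range] at h
  have hsum : ((Matrix.of fun a b : Fin n => rowCoeff a b) * matrixA n x y) a b =
      ((x + y + (b + 1) + 2 * a + 1).choose (x + a + 2 * b + 2) : ℤ) -
        ((x + y + (b + 1) + 2 * a + 1).choose (x + a + 2 * b + 2).succ : ℤ) := by
    rw [← h, Matrix.mul_apply]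
    refine Finset.sum_congr rfl fun l _ => ?_
    simp only [matrixA, Matrix.of_apply]
    push_cast
    ring_nf
  rw [Matrix.map_apply, hsum, reducedMatrix, Matrix.of_apply]
  push_cast
  rw [Nat.succ_eq_add_one, choose_sub_choose_succ]
  push_cast
  ring_nf

theorem det_matrixA (n x y : ℕ) : ((matrixA n x y).det : ℝ) = detValue n x y := by
  rw [← det_reducedMatrix, ← rowCoeff_mul_matrixA, ← Int.cast_det, Matrix.det_mul, det_rowCoeff,
    one_mul]

theorem theorem1p10 (n : ℕ) (hn : 1 ≤ n) (x y : ℕ) :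
    ((matrixA n x y).det : ℚ) =
      ∏ j ∈ Finset.Icc 1 n,
        (((j - 1).factorial : ℚ) * ((x + y + 2 * j).factorial : ℚ) *
            (shiftedFactorial ((x : ℤ) - (y : ℤ) + 2 * (j : ℤ) + 1) j : ℚ) *
            (shiftedFactorial ((x : ℤ) + 2 * (y : ℤ) + 3 * (j : ℤ) + 1) (n - j) : ℚ)) /
          (((x + n + 2 * j).factorial : ℚ) * ((y + n - j).factorial : ℚ)) := by
  have h := (det_matrixA n x y).trans (detValue_natCast n x y)
  generalize (matrixA n x y).det = d at h ⊢
  apply Rat.cast_injective (α := ℝ)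
  push_cast
  simp only [cast_shiftedFactorial]
  push_cast
  exact h
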